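/- Let $d\ge 1$ and let $X_1,X_2,\dots$ be independent, identically distributed $\mathbb{Z}^d$-valued random variables on a probability space $(\Omega,\mathcal F,\mathbb{P})$. Put $S_0=0$, $S_n=X_1+\dots+X_n$, and let $\ell(n,x)=\sum_{i=0}^n \mathbf 1_{\{S_i=x\}}$ be the number of visits to $x\in\mathbb{Z}^d$ up to time $n$. Assume: (a) the walk is genuinely $d$-dimensional: with $R^+=\bigcup_{n\ge 0}\{x\in\mathbb{Z}^d:\mathbb{P}(S_n=x)>0\}$, the set $R^+-R^+=\{x-y:x,y\in R^+\}$ spans $\mathbb{R}^d$ as a real vector space; (b) the escape probability $\gamma=\mathbb{P}(S_n\neq 0\text{ for all }n\ge 1)$ satisfies $0<\gamma<1$; (c) if $d\in\{1,2\}$, then either $\mathbb{E}|X_1|^2<\infty$, or there is $\eta>0$ with $\sum_{k=n}^\infty\mathbb{P}(S_k=0)=O(n^{-\eta})$ as $n\to\infty$. For every $n$ let $Y_n$ be a $\mathbb{Z}^d$-valued random variable on $\Omega$ whose conditional distribution given $X_1,\dots,X_n$ is the uniform distribution on the set of visited points $\{S_0,\dots,S_n\}$. Then, $\mathbb{P}$-almost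 surely, for every integer $u\ge 1$, $$\lim_{n\to\infty}\mathbb{P}\left[\ell(n,Y_n)=u\mid X_1,\dots,X_n\right]=\gamma(1-\gamma)^{u-1}.$$ -/

import Mathlib

open MeasureTheory ProbabilityTheory Filter Topology

noncomputable section

namespace LatticeWalk

variable {Ω : Type*} {d : ℕ}

/-- The walk `S_n = X_1 + ... + X_n`, `S_0 = 0`. The steps are indexed from `0`:
`X i` is the `(i+1)`-st step. -/
def walk (X : ℕ → Ω → (Fin d → ℤ)) (n : ℕ) (ω : Ω) : Fin d → ℤ :=
  ∑ i ∈ Finset.range n, X i ω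

/-- The local time `ℓ(n,x)`: the number of visits to `x` at the times `0, ..., n`. -/
def localTime (X : ℕ → Ω → (Fin d → ℤ)) (n : ℕ) (x : Fin d → ℤ) (ω : Ω) : ℕ :=
  ∑ i ∈ Finset.range (n + 1), if walk X i ω = x then 1 else 0

/-- The set `{S_0, ..., S_n}` of visited sites. -/
def visited (X : ℕ → Ω → (Fin d → ℤ)) (n : ℕ) (ω : Ω) : Set (Fin d → ℤ) :=
  {x | ∃ i ≤ n, walk X i ω = x}

/-- The σ-algebra generated by the first `n` steps. -/
abbrev stepsSigma (X : ℕ → Ω → (Fin d → ℤ)) (n : ℕ) : MeasurableSpace Ω :=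
  MeasurableSpace.comap (fun (ω : Ω) (i : Fin n) => X i ω) MeasurableSpace.pi

/-- `R⁺`: the sites that are visited with positive probability at some time `n ≥ 0`. -/
def support [MeasurableSpace Ω] (X : ℕ → Ω → (Fin d → ℤ)) (μ : Measure Ω) : Set (Fin d → ℤ) :=
  {x | ∃ n : ℕ, 0 < μ {ω | walk X n ω = x}}

/-- The walk is genuinely `d`-dimensional: `R⁺ - R⁺`, seen as a subset of `ℝ^d`, spans `ℝ^d`. -/
def GenuinelyDDimensional [MeasurableSpace Ω] (X : ℕ → Ω → (Fin d → ℤ)) (μ : Measure Ω) : Prop :=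
  Submodule.span ℝ {v : Fin d → ℝ | ∃ x ∈ support X μ, ∃ y ∈ support X μ,
    v = fun j => ((x j - y j : ℤ) : ℝ)} = ⊤

/-- The escape probability `P(S_n ≠ 0 for all n ≥ 1)`. -/
def escapeProb [MeasurableSpace Ω] (X : ℕ → Ω → (Fin d → ℤ)) (μ : Measure Ω) : ℝ :=
  μ.real {ω | ∀ n : ℕ, 1 ≤ n → walk X n ω ≠ 0}

/-- The (first, hence every) step has a finite second moment. -/
def FiniteSecondMoment [MeasurableSpace Ω] (X : ℕ → Ω → (Fin d → ℤ)) (μ : Measure Ω) : Prop :=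
  Integrable (fun ω => ∑ j : Fin d, ((X 0 ω j : ℤ) : ℝ) ^ 2) μ

/-- `∑_{k ≥ n} P(S_k = 0) = O(n^{-η})` as `n → ∞`, for some `η > 0`. The sum is taken in
`[0,∞]`. -/
def PolynomialReturnTail [MeasurableSpace Ω] (X : ℕ → Ω → (Fin d → ℤ)) (μ : Measure Ω) : Prop :=
  ∃ η : ℝ, 0 < η ∧ ∃ C : ℝ, ∀ᶠ n : ℕ in atTop,
    ∑' k : ℕ, μ {ω | walk X (n + k) ω = 0} ≤ ENNReal.ofReal (C * (n : ℝ) ^ (-η))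

/-- Given the first `n` steps, `Z` is uniformly distributed on `{S_0, ..., S_n}`. -/
def IsUniformOnVisited [MeasurableSpace Ω] (X : ℕ → Ω → (Fin d → ℤ)) (μ : Measure Ω) (n : ℕ)
    (Z : Ω → (Fin d → ℤ)) : Prop :=
  Measurable Z ∧ ∀ A : Set (Fin d → ℤ), MeasurableSet A →
    μ⟦Z ⁻¹' A | stepsSigma X n⟧ =ᵐ[μ] fun ω => (uniformOn (visited X n ω)).real A

end LatticeWalk

end

/-! A site visited more than `v` times among the times `0, ..., n - 1` has exactly one visit
followed by exactly `v` further visits before time `n`. Hence the number of such sites equals the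
number of times `i < n` with exactly `v` later visits to the current position
(`card_filter_later_eq`, `revisitCount_eq_card`). The sites are thereby counted through a sum over
times, to which stationarity of the steps applies.

Over an infinite horizon, the number of returns is geometric: it equals `v` with probability `γ (1 -
γ) ^ v`, where `γ` is the escape probability. Truncating at horizon `M` gives a function of finitely
many steps, for which the strong law holds (`tendsto_birkhoffSum_of_finite_range`). The truncation
error is at most `M + 1` plus the number of `i < n` from which the walk returns after more than `M`
steps (`abs_revisitCount_sub_birkhoffSum_le`). Since `γ > 0`, such late returns have small
probability, and the maximal ergodic inequality bounds their frequency uniformly in `n`. So the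
times with exactly `v` later visits have frequency tending to `γ (1 - γ) ^ v`
(`tendsto_revisitCount_div`).

The conditional probability in the theorem is the proportion of visited sites having local time `u`,
a quotient of such counts. Its limit is `(γ (1 - γ) ^ (u - 1) - γ (1 - γ) ^ u) / γ`. -/

/-! ### Maximal ergodic inequality. -/

section MaximalErgodic

variable {α : Type*} {mα : MeasurableSpace α} {P : Measure α} {T : α → α} {f : α → ℝ}

/-- The maximum of the Birkhoff sums of length at most `N`, including the empty one. -/
noncomputable def birkhoffMax (T : α → α) (f : α → ℝ) (N : ℕ) (x : α) : ℝ :=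
  (Finset.range (N + 1)).sup' Finset.nonempty_range_add_one fun k => birkhoffSum T f k x

lemma birkhoffSum_le_birkhoffMax {N k : ℕ} (hk : k ≤ N) (x : α) :
    birkhoffSum T f k x ≤ birkhoffMax T f N x :=
  Finset.le_sup' (fun k => birkhoffSum T f k x) (Finset.mem_range.2 (Nat.lt_succ_of_le hk))

lemma birkhoffMax_nonneg (N : ℕ) (x : α) : 0 ≤ birkhoffMax T f N x := by
  simpa using birkhoffSum_le_birkhoffMax (T := T) (f := f) (Nat.zero_le N) x

/-- A positive maximum is not attained by the empty sum, so the first term `f x` can be split off;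
what remains is a shorter sum started at `T x`. -/
lemma birkhoffMax_le_add {N : ℕ} {x : α} (h : 0 < birkhoffMax T f N x) :
    birkhoffMax T f N x ≤ f x + birkhoffMax T f N (T x) := by
  obtain ⟨k, hk, hkx⟩ := Finset.exists_mem_eq_sup' (Finset.nonempty_range_add_one (n := N))
    fun k => birkhoffSum T f k x
  change birkhoffMax T f N x = _ at hkx
  rw [Finset.mem_range] at hk
  rcases k with _ | k
  · simp [hkx] at h
  · rw [hkx, birkhoffSum_succ']
    have := birkhoffSum_le_birkhoffMax (T := T) (f := f) (N := N) (k := k) (by omega) (T x)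
    linarith

lemma integrable_birkhoffSum (hT : MeasurePreserving T P P) (hf : Integrable f P) (n : ℕ) :
    Integrable (birkhoffSum T f n) P := by
  unfold birkhoffSum
  exact integrable_finsetSum _ fun k _ => (hT.iterate k).integrable_comp_of_integrable hf

lemma integrable_birkhoffMax (hT : MeasurePreserving T P P) (hf : Integrable f P) (N : ℕ) :
    Integrable (birkhoffMax T f N) P := by
  have : birkhoffMax T f N = (Finset.range (N + 1)).sup' Finset.nonempty_range_add_one
      fun k => birkhoffSum T f k := by
    ext x
    rw [Finset.sup'_apply]
    rfl
  rw [this]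
  refine Finset.sup'_induction _ _ (p := fun g => Integrable g P) ?_ ?_
  · exact fun _ h₁ _ h₂ => h₁.sup h₂
  · exact fun k _ => integrable_birkhoffSum hT hf k

lemma measurable_birkhoffSum (hT : Measurable T) (hf : Measurable f) (n : ℕ) :
    Measurable (birkhoffSum T f n) := by
  unfold birkhoffSum
  exact Finset.measurable_sum _ fun k _ => hf.comp (hT.iterate k)

lemma measurable_birkhoffMax (hT : Measurable T) (hf : Measurable f) (N : ℕ) :
    Measurable (birkhoffMax T f N) := by
  unfold birkhoffMax
  exact Finset.measurable_range_sup'' fun k _ => measurable_birkhoffSum hT hf k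

/-- The maximal ergodic theorem, by Garsia's argument. -/
lemma setIntegral_birkhoffMax_pos_nonneg (hT : MeasurePreserving T P P) (hf : Integrable f P)
    (hfm : Measurable f) (N : ℕ) :
    0 ≤ ∫ x in {x | 0 < birkhoffMax T f N x}, f x ∂P := by
  set A := {x | 0 < birkhoffMax T f N x}
  have hA : MeasurableSet A :=
    measurableSet_lt measurable_const (measurable_birkhoffMax hT.measurable hfm N)
  have hM := integrable_birkhoffMax hT hf N
  have hMT : Integrable (fun x => birkhoffMax T f N (T x)) P :=
    hT.integrable_comp_of_integrable hM
  have h₁ : ∫ x in A, (birkhoffMax T f N x - birkhoffMax T f N (T x)) ∂P ≤ ∫ x in A, f x ∂P := by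
    refine setIntegral_mono_on (hM.sub hMT).integrableOn hf.integrableOn hA fun x hx => ?_
    linarith [birkhoffMax_le_add hx]
  rw [integral_sub hM.integrableOn hMT.integrableOn] at h₁
  have h₂ : ∫ x in A, birkhoffMax T f N x ∂P = ∫ x, birkhoffMax T f N x ∂P := by
    refine setIntegral_eq_integral_of_forall_compl_eq_zero fun x hx => ?_
    exact le_antisymm (not_lt.1 hx) (birkhoffMax_nonneg N x)
  have h₃ : ∫ x in A, birkhoffMax T f N (T x) ∂P ≤ ∫ x, birkhoffMax T f N (T x) ∂P :=
    setIntegral_le_integral hMT (ae_of_all _ fun x => birkhoffMax_nonneg N (T x))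
  have h₄ : ∫ x, birkhoffMax T f N (T x) ∂P = ∫ x, birkhoffMax T f N x ∂P := by
    conv_rhs => rw [← hT.map_eq]
    rw [integral_map hT.measurable.aemeasurable]
    rw [hT.map_eq]
    exact hM.aestronglyMeasurable
  linarith

/-- The weak type inequality for the ergodic maximal function of an indicator. -/
lemma measureReal_exists_lt_birkhoffSum_le [IsProbabilityMeasure P] (hT : MeasurePreserving T P P)
    {B : Set α} (hB : MeasurableSet B) {ε : ℝ} (hε : 0 < ε) :
    P.real {x | ∃ n : ℕ, ε * n < birkhoffSum T (B.indicator 1) n x} ≤ P.real B / ε := by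
  set f : α → ℝ := fun x => B.indicator 1 x - ε
  have hfm : Measurable f := (measurable_one.indicator hB).sub_const ε
  have hBi : Integrable (B.indicator (1 : α → ℝ)) P := (integrable_const (1 : ℝ)).indicator hB
  have hf : Integrable f P := hBi.sub (integrable_const ε)
  have hsum : ∀ n x, birkhoffSum T f n x = birkhoffSum T (B.indicator 1) n x - ε * n := by
    intro n x
    simp [birkhoffSum, f, mul_comm]
  have hN : ∀ N, P.real {x | 0 < birkhoffMax T f N x} ≤ P.real B / ε := by
    intro N
    have h := setIntegral_birkhoffMax_pos_nonneg hT hf hfm N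
    rw [integral_sub hBi.integrableOn (integrable_const ε).integrableOn] at h
    have h₁ : ∫ x in {x | 0 < birkhoffMax T f N x}, B.indicator 1 x ∂P ≤ P.real B := by
      rw [← integral_indicator_one hB]
      exact setIntegral_le_integral hBi
        (ae_of_all _ fun x => Set.indicator_nonneg (fun _ _ => zero_le_one) x)
    simp only [setIntegral_const, smul_eq_mul] at h
    rw [le_div_iff₀ hε]
    linarith
  have hU : {x | ∃ n : ℕ, ε * n < birkhoffSum T (B.indicator 1) n x}
      = ⋃ N, {x | 0 < birkhoffMax T f N x} := by
    ext x
    simp only [Set.mem_ofPred_eq, Set.mem_iUnion]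
    constructor
    · rintro ⟨n, hn⟩
      refine ⟨n, lt_of_lt_of_le ?_ (birkhoffSum_le_birkhoffMax le_rfl x)⟩
      rw [hsum]; linarith
    · rintro ⟨N, hN⟩
      obtain ⟨k, -, hk⟩ := (Finset.lt_sup'_iff _).1 hN
      rw [hsum] at hk
      exact ⟨k, by linarith⟩
  rw [hU]
  have hmono : Monotone fun N => {x | 0 < birkhoffMax T f N x} := by
    intro N N' h x hx
    obtain ⟨k, hkN, hk⟩ := (Finset.lt_sup'_iff _).1 (show 0 < birkhoffMax T f N x from hx)
    rw [Finset.mem_range] at hkN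
    exact hk.trans_le (birkhoffSum_le_birkhoffMax (by omega) x)
  have ht := (ENNReal.tendsto_toReal (measure_ne_top P _)).comp
    (tendsto_measure_iUnion_atTop (μ := P) hmono)
  exact le_of_tendsto' ht hN

end MaximalErgodic

/-! ### The shift on i.i.d. sequences and the strong law for finite windows. -/

section Shift

variable {E : Type*}

/-- The left shift on sequences. -/
def seqShift (w : ℕ → E) (i : ℕ) : E := w (i + 1)

lemma seqShift_iterate (n : ℕ) (w : ℕ → E) (i : ℕ) : (seqShift^[n] w) i = w (i + n) := by
  induction n generalizing i with
  | zero => rfl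
  | succ n ih =>
    rw [Function.iterate_succ_apply', seqShift, ih]
    congr 1
    omega

variable [MeasurableSpace E] {ν : Measure E} [IsProbabilityMeasure ν]

lemma measurePreserving_seqShift :
    MeasurePreserving (seqShift (E := E)) (Measure.infinitePi fun _ : ℕ => ν)
      (Measure.infinitePi fun _ : ℕ => ν) where
  measurable := by unfold seqShift; fun_prop
  map_eq := Measure.map_infinitePi_infinitePi_of_inj (P := fun _ : ℕ => ν)
    (f := fun i : ℕ => i + 1) (add_left_injective 1)

lemma indepFun_blocks {ι κ : Type*} (a : ι → ℕ) (b : κ → ℕ) (hab : ∀ i j, a i ≠ b j) :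
    IndepFun (fun (w : ℕ → E) i => w (a i)) (fun w j => w (b j))
      (Measure.infinitePi fun _ : ℕ => ν) := by
  have h : iIndepFun (fun (i : ℕ) (w : ℕ → E) => w i) (Measure.infinitePi fun _ : ℕ => ν) :=
    iIndepFun_infinitePi (X := fun _ x => x) fun _ => measurable_id
  rw [IndepFun_iff_Indep]
  have hi := indep_iSup_of_disjoint (fun i : ℕ => (measurable_pi_apply i).comap_le)
    ((iIndepFun_iff_iIndep _ _ _).1 h) (S := Set.range a) (T := Set.range b)
    (Set.disjoint_left.2 (by rintro _ ⟨i, rfl⟩ ⟨j, hj⟩; exact hab i j hj.symm))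
  refine indep_of_indep_of_le_left (indep_of_indep_of_le_right hi ?_) ?_
  · simp only [MeasurableSpace.pi, MeasurableSpace.comap_iSup, MeasurableSpace.comap_comp]
    exact iSup_le fun j => le_iSup₂_of_le (b j) ⟨j, rfl⟩ le_rfl
  · simp only [MeasurableSpace.pi, MeasurableSpace.comap_iSup, MeasurableSpace.comap_comp]
    exact iSup_le fun j => le_iSup₂_of_le (a j) ⟨j, rfl⟩ le_rfl

/-- For `r < m`, the quotient `(n + (m - 1 - r)) / m` is the number of `k` with `k * m + r < n`. -/
lemma sum_range_eq_sum_residues (a : ℕ → ℝ) {m : ℕ} (hm : 0 < m) (n : ℕ) :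
    ∑ i ∈ Finset.range n, a i =
      ∑ r ∈ Finset.range m, ∑ k ∈ Finset.range ((n + (m - 1 - r)) / m), a (k * m + r) := by
  have key : ∀ r < m, ∀ k, k < (n + (m - 1 - r)) / m ↔ k * m + r < n := by
    intro r hr k
    rw [Nat.lt_iff_add_one_le, Nat.le_div_iff_mul_le hm, add_mul, one_mul]
    omega
  rw [Finset.sum_sigma']
  refine Finset.sum_bij' (fun i _ => ⟨i % m, i / m⟩) (fun x _ => x.2 * m + x.1) ?_ ?_ ?_ ?_ ?_
  · intro i hi
    have hr := Nat.mod_lt i hm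
    simp only [Finset.mem_sigma, Finset.mem_range, key _ hr] at hi ⊢
    exact ⟨hr, by rwa [Nat.div_add_mod']⟩
  · rintro ⟨r, k⟩ hx
    simp only [Finset.mem_sigma, Finset.mem_range] at hx ⊢
    exact (key r hx.1 k).1 hx.2
  · intro i _
    exact Nat.div_add_mod' i m
  · rintro ⟨r, k⟩ hx
    simp only [Finset.mem_sigma, Finset.mem_range] at hx
    have h₁ : (k * m + r) % m = r := by
      rw [Nat.mul_add_mod', Nat.mod_eq_of_lt hx.1]
    have h₂ : (k * m + r) / m = k := by
      rw [mul_comm, Nat.mul_add_div hm, Nat.div_eq_of_lt hx.1, add_zero]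
    simp only [h₁, h₂]
  · intro i _
    simp only [Nat.div_add_mod']

/-- Averages of a sequence converge as soon as they do along the residue classes mod `m`. -/
lemma tendsto_average_of_residues {a : ℕ → ℝ} {m : ℕ} (hm : 0 < m) {p : ℝ}
    (h : ∀ r < m, Tendsto (fun q : ℕ => (∑ k ∈ Finset.range q, a (k * m + r)) / q) atTop (𝓝 p)) :
    Tendsto (fun n : ℕ => (∑ i ∈ Finset.range n, a i) / n) atTop (𝓝 p) := by
  have hm' : (0 : ℝ) < m := by exact_mod_cast hm
  have key : ∀ r ∈ Finset.range m, Tendsto (fun n : ℕ =>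
      (∑ k ∈ Finset.range ((n + (m - 1 - r)) / m), a (k * m + r)) / n) atTop (𝓝 (p * (1 / m))) := by
    intro r hr
    set c : ℕ → ℕ := fun n => (n + (m - 1 - r)) / m
    have hc₁ : ∀ n : ℕ, (n : ℝ) ≤ m * c n + m := by
      intro n
      have := Nat.lt_div_mul_add (a := n + (m - 1 - r)) hm
      have h' : n ≤ m * c n + m := by
        rw [mul_comm m (c n)]; change n ≤ (n + (m - 1 - r)) / m * m + m; omega
      exact_mod_cast h'
    have hc₂ : ∀ n : ℕ, (m * c n : ℝ) ≤ n + m := by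
      intro n
      have := Nat.mul_div_le (n + (m - 1 - r)) m
      have h' : m * c n ≤ n + m := by change m * ((n + (m - 1 - r)) / m) ≤ n + m; omega
      exact_mod_cast h'
    have hctop : Tendsto c atTop atTop :=
      (Nat.tendsto_div_const_atTop hm.ne').comp (tendsto_add_atTop_nat _)
    have hratio : Tendsto (fun n : ℕ => (c n : ℝ) / n) atTop (𝓝 (1 / m)) := by
      have h0 : Tendsto (fun n : ℕ => (1 : ℝ) / n) atTop (𝓝 0) := tendsto_one_div_atTop_nhds_zero_nat
      rw [tendsto_iff_norm_sub_tendsto_zero]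
      refine squeeze_zero' (Eventually.of_forall fun _ => norm_nonneg _) ?_ h0
      filter_upwards [eventually_gt_atTop 0] with n hn
      have hn' : (0 : ℝ) < n := by exact_mod_cast hn
      have : (c n : ℝ) / n - 1 / m = (m * c n - n) / (m * n) := by field_simp
      rw [this, Real.norm_eq_abs, abs_div, abs_of_pos (mul_pos hm' hn'), div_le_div_iff₀
        (mul_pos hm' hn') hn', one_mul]
      refine mul_le_mul_of_nonneg_right ?_ hn'.le
      rw [abs_le]
      constructor <;> linarith [hc₁ n, hc₂ n]
    refine (((h r (Finset.mem_range.1 hr)).comp hctop).mul hratio).congr' ?_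
    filter_upwards [hctop.eventually_gt_atTop 0] with n hn
    have hn' : (c n : ℝ) ≠ 0 := by exact_mod_cast hn.ne'
    simp only [Function.comp_apply]
    rw [div_mul_div_cancel₀ hn']
  have := tendsto_finsetSum _ key
  simp only [Finset.sum_const, Finset.card_range, nsmul_eq_mul] at this
  rw [show (m : ℝ) * (p * (1 / m)) = p by field_simp] at this
  refine this.congr fun n => ?_
  rw [sum_range_eq_sum_residues a hm n, Finset.sum_div]

/-- The strong law of large numbers along the shift for functions of finitely many coordinates. -/
lemma tendsto_birkhoffSum_of_finite_range {m : ℕ} {g : (Fin m → E) → ℝ} (hg : Measurable g)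
    (hgi : Integrable (fun w : ℕ → E => g fun i => w i) (Measure.infinitePi fun _ : ℕ => ν)) :
    ∀ᵐ w ∂(Measure.infinitePi fun _ : ℕ => ν),
      Tendsto (fun n : ℕ => birkhoffSum seqShift (fun w : ℕ → E => g fun i => w i) n w / n) atTop
        (𝓝 (∫ w, g (fun i => w i) ∂(Measure.infinitePi fun _ : ℕ => ν))) := by
  set P := Measure.infinitePi fun _ : ℕ => ν
  set f : (ℕ → E) → ℝ := fun w => g fun i => w i
  have hfm : Measurable f := hg.comp (by fun_prop)
  have hident : ∀ n, IdentDistrib (fun w => f (seqShift^[n] w)) f P P := fun n => by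
    have hT : MeasurePreserving (seqShift^[n]) P P := measurePreserving_seqShift.iterate n
    have h : IdentDistrib (seqShift^[n]) id P P :=
      ⟨hT.measurable.aemeasurable, aemeasurable_id, by rw [hT.map_eq, Measure.map_id]⟩
    exact h.comp hfm
  -- Windows of length `m` whose starting points are `m + 1` apart are disjoint, so along a residue
  -- class the terms are independent. The spacing `m + 1` stays positive when `m = 0`.
  have hres : ∀ᵐ w ∂P, ∀ r, Tendsto (fun q : ℕ =>
      (∑ k ∈ Finset.range q, f (seqShift^[k * (m + 1) + r] w)) / q) atTop (𝓝 (∫ w, f w ∂P)) := by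
    rw [ae_all_iff]
    intro r
    have hint : ∫ w, f (seqShift^[0 * (m + 1) + r] w) ∂P = ∫ w, f w ∂P := (hident _).integral_eq
    rw [← hint]
    refine strong_law_ae_real (fun k w => f (seqShift^[k * (m + 1) + r] w))
      ((hident _).integrable_iff.2 hgi) ?_ fun k => (hident _).trans (hident _).symm
    intro k l hkl
    have hi := indepFun_blocks (ν := ν) (fun i : Fin m => (i : ℕ) + (k * (m + 1) + r))
      (fun i : Fin m => (i : ℕ) + (l * (m + 1) + r)) (by
        intro i j hij
        have hi := i.2
        have hj := j.2
        rcases Nat.lt_or_gt_of_ne hkl with h | h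
        · have := Nat.mul_le_mul_right (m + 1) (Nat.succ_le_of_lt h)
          rw [Nat.succ_mul] at this
          omega
        · have := Nat.mul_le_mul_right (m + 1) (Nat.succ_le_of_lt h)
          rw [Nat.succ_mul] at this
          omega)
    have := hi.comp hg hg
    convert this using 1
    all_goals
      ext w
      simp [f, seqShift_iterate]
  filter_upwards [hres] with w hw
  exact tendsto_average_of_residues (Nat.succ_pos m) fun r _ => hw r

end Shift

/-! ### Returns to the origin: geometric law and frequencies along the walk. -/

section Returns

variable {E : Type*} [AddCommGroup E]

/-- The partial sums of a sequence of steps. -/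
def partialSum (w : ℕ → E) (n : ℕ) : E := ∑ i ∈ Finset.range n, w i

lemma partialSum_add (w : ℕ → E) (n k : ℕ) :
    partialSum w (n + k) = partialSum w n + partialSum (seqShift^[n] w) k := by
  simp only [partialSum, Finset.sum_range_add, seqShift_iterate, add_comm _ n]

variable [DecidableEq E]

/-- The number of returns to the origin at the times `1, ..., M`. -/
def returnCount (M : ℕ) (w : ℕ → E) : ℕ :=
  ((Finset.range M).filter fun k => partialSum w (k + 1) = 0).card

lemma returnCount_add (a M : ℕ) (w : ℕ → E) : returnCount (a + M) w = returnCount a w +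
    ((Finset.range M).filter fun k => partialSum w (a + k + 1) = 0).card := by
  simp only [returnCount, Finset.card_filter, Finset.sum_range_add]

lemma returnCount_mono (w : ℕ → E) : Monotone fun M => returnCount M w := by
  intro M N h
  obtain ⟨k, rfl⟩ := Nat.exists_eq_add_of_le h
  simp [returnCount_add]

lemma returnCount_add_of_partialSum_eq_zero {a : ℕ} {w : ℕ → E} (h : partialSum w a = 0) (M : ℕ) :
    returnCount (a + M) w = returnCount a w + returnCount M (seqShift^[a] w) := by
  rw [returnCount_add]
  simp only [returnCount, add_assoc, partialSum_add w a, h, zero_add]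

/-- The sequences of steps whose walk first returns to the origin at time `t + 1`. -/
def firstReturn (E : Type*) [AddCommGroup E] (t : ℕ) : Set (ℕ → E) :=
  {w | partialSum w (t + 1) = 0 ∧ ∀ k < t, partialSum w (k + 1) ≠ 0}

/-- The sequences of steps whose walk returns to the origin at least `v` times. -/
def returnsAtLeast (E : Type*) [AddCommGroup E] [DecidableEq E] (v : ℕ) : Set (ℕ → E) :=
  {w | ∃ M, v ≤ returnCount M w}

lemma returnCount_of_mem_firstReturn {t : ℕ} {w : ℕ → E} (h : w ∈ firstReturn E t) :
    returnCount (t + 1) w = 1 := by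
  rw [returnCount, Finset.card_eq_one]
  refine ⟨t, ?_⟩
  ext k
  simp only [Finset.mem_filter, Finset.mem_range, Finset.mem_singleton]
  constructor
  · rintro ⟨hk, h0⟩
    by_contra hne
    exact h.2 k (by omega) h0
  · rintro rfl
    exact ⟨Nat.lt_succ_self _, h.1⟩

omit [DecidableEq E] in
lemma exists_mem_firstReturn {k : ℕ} {w : ℕ → E} (h : partialSum w (k + 1) = 0) :
    ∃ t, w ∈ firstReturn E t := by
  classical
  have hex : ∃ k, partialSum w (k + 1) = 0 := ⟨k, h⟩
  exact ⟨Nat.find hex, Nat.find_spec hex, fun j hj => Nat.find_min hex hj⟩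

omit [DecidableEq E] in
lemma firstReturn_pairwise_disjoint : Pairwise (Function.onFun Disjoint (firstReturn E)) := by
  intro s t hst
  refine Set.disjoint_left.2 fun w hs ht => ?_
  rcases Nat.lt_or_gt_of_ne hst with h | h
  · exact ht.2 s h hs.1
  · exact hs.2 t h ht.1

/-- The walk restarts afresh at its first return; this decomposition drives the induction giving the
geometric law. -/
lemma returnsAtLeast_succ (v : ℕ) : returnsAtLeast E (v + 1) =
    ⋃ t, firstReturn E t ∩ (seqShift^[t + 1]) ⁻¹' returnsAtLeast E v := by
  ext w
  simp only [Set.mem_iUnion, Set.mem_inter_iff, Set.mem_preimage]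
  constructor
  · rintro ⟨M, hM⟩
    have hpos : 0 < returnCount M w := by omega
    obtain ⟨k, hk⟩ := Finset.card_pos.1 hpos
    obtain ⟨t, ht⟩ := exists_mem_firstReturn (Finset.mem_filter.1 hk).2
    -- The same `M` works: up to time `t + 1 + M` there are at least `v + 1` returns, exactly one of
    -- them by time `t + 1`.
    refine ⟨t, ht, M, ?_⟩
    have h₁ := returnCount_add_of_partialSum_eq_zero ht.1 M
    have h₂ := returnCount_mono w (Nat.le_add_left M (t + 1))
    rw [returnCount_of_mem_firstReturn ht] at h₁
    simp only at h₂
    omega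
  · rintro ⟨t, ht, M, hM⟩
    refine ⟨t + 1 + M, ?_⟩
    rw [returnCount_add_of_partialSum_eq_zero ht.1, returnCount_of_mem_firstReturn ht]
    omega

omit [DecidableEq E] in
lemma compl_setOf_ne_zero_eq :
    {w : ℕ → E | ∀ n, 1 ≤ n → partialSum w n ≠ 0}ᶜ = ⋃ t, firstReturn E t := by
  ext w
  simp only [Set.mem_compl_iff, Set.mem_ofPred_eq, Set.mem_iUnion]
  constructor
  · intro h
    push Not at h
    obtain ⟨n, hn, h0⟩ := h
    obtain ⟨k, rfl⟩ := Nat.exists_eq_add_of_le' hn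
    exact exists_mem_firstReturn h0
  · rintro ⟨t, ht⟩ h
    exact h (t + 1) (by omega) ht.1

/-- The sequences of steps whose walk is at the origin at some time after `M`. -/
def returnsAfter (E : Type*) [AddCommGroup E] (M : ℕ) : Set (ℕ → E) :=
  {w | ∃ k, M < k ∧ partialSum w k = 0}

omit [DecidableEq E] in
lemma returnsAfter_antitone : Antitone (returnsAfter E) :=
  fun _ _ h _ ⟨k, hk, h0⟩ => ⟨k, h.trans_lt hk, h0⟩

/-- A walk that returns after every time returns infinitely often. -/
lemma iInter_returnsAfter_subset (v : ℕ) : ⋂ M, returnsAfter E M ⊆ returnsAtLeast E v := by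
  intro w hw
  induction v with
  | zero => exact ⟨0, Nat.zero_le _⟩
  | succ v ih =>
    obtain ⟨M, hM⟩ := ih
    obtain ⟨k, hk, h0⟩ := Set.mem_iInter.1 hw M
    obtain ⟨j, rfl⟩ := Nat.exists_eq_add_of_lt hk
    refine ⟨M + (j + 1), ?_⟩
    rw [returnCount_add]
    have : 0 < ((Finset.range (j + 1)).filter fun k => partialSum w (M + k + 1) = 0).card :=
      Finset.card_pos.2 ⟨j, by simp [h0]⟩
    omega

lemma returnCount_eq_of_notMem_returnsAfter {M N : ℕ} (h : M ≤ N) {w : ℕ → E}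
    (hw : w ∉ returnsAfter E M) : returnCount N w = returnCount M w := by
  obtain ⟨k, rfl⟩ := Nat.exists_eq_add_of_le h
  rw [returnCount_add, Nat.add_eq_left, Finset.card_eq_zero, Finset.filter_eq_empty_iff]
  intro j _ h0
  exact hw ⟨M + j + 1, by omega, h0⟩

variable [MeasurableSpace E] [MeasurableAdd₂ E] [MeasurableSingletonClass E]
  {ν : Measure E} [IsProbabilityMeasure ν]

omit [DecidableEq E] [MeasurableSingletonClass E] in
@[fun_prop]
lemma measurable_partialSum (n : ℕ) : Measurable fun w : ℕ → E => partialSum w n :=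
  Finset.measurable_fun_sum _ fun i _ => measurable_pi_apply i

omit [DecidableEq E] in
lemma measurableSet_partialSum_eq_zero (n : ℕ) :
    MeasurableSet {w : ℕ → E | partialSum w n = 0} :=
  measurable_partialSum n (measurableSet_singleton 0)

@[fun_prop]
lemma measurable_returnCount (M : ℕ) : Measurable (returnCount (E := E) M) := by
  unfold returnCount
  simp only [Finset.card_filter]
  exact Finset.measurable_fun_sum _ fun k _ =>
    Measurable.ite (measurableSet_partialSum_eq_zero _) measurable_const measurable_const

lemma measurableSet_returnsAtLeast (v : ℕ) : MeasurableSet (returnsAtLeast E v) := by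
  have : returnsAtLeast E v = ⋃ M, returnCount M ⁻¹' Set.Ici v := by
    ext w; simp [returnsAtLeast]
  rw [this]
  exact .iUnion fun M => measurable_returnCount M measurableSet_Ici

omit [DecidableEq E] in
lemma measurableSet_returnsAfter (M : ℕ) : MeasurableSet (returnsAfter E M) := by
  have : returnsAfter E M = ⋃ k, ⋃ _ : M < k, {w | partialSum w k = 0} := by
    ext w; simp [returnsAfter]
  rw [this]
  exact .iUnion fun k => .iUnion fun _ => measurableSet_partialSum_eq_zero k

omit [DecidableEq E] in
lemma measurableSet_firstReturn (t : ℕ) : MeasurableSet (firstReturn E t) := by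
  have : firstReturn E t =
      {w | partialSum w (t + 1) = 0} ∩ ⋂ k, ⋂ _ : k < t, {w | partialSum w (k + 1) = 0}ᶜ := by
    ext w; simp [firstReturn]
  rw [this]
  exact (measurableSet_partialSum_eq_zero _).inter
    (.iInter fun k => .iInter fun _ => (measurableSet_partialSum_eq_zero _).compl)

/-- A walk whose steps are the given ones up to time `m` and zero afterwards. -/
def extendByZero {m : ℕ} (x : Fin m → E) (i : ℕ) : E := if h : i < m then x ⟨i, h⟩ else 0

omit [DecidableEq E] [MeasurableSpace E] [MeasurableAdd₂ E] [MeasurableSingletonClass E] in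
lemma partialSum_extendByZero {m n : ℕ} (h : n ≤ m) (w : ℕ → E) :
    partialSum (extendByZero fun i : Fin m => w i) n = partialSum w n := by
  refine Finset.sum_congr rfl fun i hi => ?_
  rw [Finset.mem_range] at hi
  simp [extendByZero, hi.trans_le h]

omit [DecidableEq E] [MeasurableAdd₂ E] [MeasurableSingletonClass E] in
lemma measurable_extendByZero (m : ℕ) : Measurable (extendByZero (E := E) (m := m)) := by
  refine measurable_pi_lambda _ fun i => ?_
  unfold extendByZero
  split_ifs <;> fun_prop

-- The Markov property at the first return: that event depends on the first `t + 1` steps only, and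
-- the shifted event on the later ones. Extending by zero exhibits the first dependence measurably.
omit [DecidableEq E] in
lemma firstReturn_inter_shift (t : ℕ) {A : Set (ℕ → E)} (hA : MeasurableSet A) :
    (Measure.infinitePi fun _ : ℕ => ν) (firstReturn E t ∩ (seqShift^[t + 1]) ⁻¹' A) =
      (Measure.infinitePi fun _ : ℕ => ν) (firstReturn E t) *
        (Measure.infinitePi fun _ : ℕ => ν) A := by
  have hi := indepFun_blocks (ν := ν) (fun i : Fin (t + 1) => (i : ℕ)) (fun j : ℕ => j + (t + 1))
    (by intro i j; have := i.2; omega)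
  have h₁ : firstReturn E t =
      (fun (w : ℕ → E) (i : Fin (t + 1)) => w i) ⁻¹' (extendByZero ⁻¹' firstReturn E t) := by
    ext w
    simp only [firstReturn, Set.mem_preimage, Set.mem_ofPred_eq]
    rw [partialSum_extendByZero le_rfl]
    refine and_congr_right fun _ => forall₂_congr fun k hk => ?_
    rw [partialSum_extendByZero (by omega)]
  have h₂ : (seqShift^[t + 1]) ⁻¹' A = (fun (w : ℕ → E) (j : ℕ) => w (j + (t + 1))) ⁻¹' A := by
    congr 1
    ext w j
    exact seqShift_iterate _ _ _
  have hshift : (Measure.infinitePi fun _ : ℕ => ν) ((seqShift^[t + 1]) ⁻¹' A) =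
      (Measure.infinitePi fun _ : ℕ => ν) A :=
    (measurePreserving_seqShift.iterate (t + 1)).measure_preimage hA.nullMeasurableSet
  rw [← hshift]
  conv_lhs => rw [h₁, h₂]
  conv_rhs => rw [h₁, h₂]
  exact hi.measure_inter_preimage_eq_mul _ _
    (measurable_extendByZero _ (measurableSet_firstReturn t)) hA

variable (ν) in
/-- The probability that the walk never returns to the origin. -/
noncomputable def noReturnProb : ℝ :=
  (Measure.infinitePi fun _ : ℕ => ν).real {w | ∀ n, 1 ≤ n → partialSum w n ≠ 0}

omit [DecidableEq E] in
lemma measure_iUnion_firstReturn :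
    (Measure.infinitePi fun _ : ℕ => ν) (⋃ t, firstReturn E t) =
      ENNReal.ofReal (1 - noReturnProb ν) := by
  have hm : MeasurableSet {w : ℕ → E | ∀ n, 1 ≤ n → partialSum w n ≠ 0} := by
    rw [← MeasurableSet.compl_iff, compl_setOf_ne_zero_eq]
    exact .iUnion measurableSet_firstReturn
  rw [← compl_setOf_ne_zero_eq, ← ofReal_measureReal, probReal_compl_eq_one_sub hm, noReturnProb]

/-- The number of returns has a geometric distribution. -/
lemma measureReal_returnsAtLeast (v : ℕ) :
    (Measure.infinitePi fun _ : ℕ => ν).real (returnsAtLeast E v) = (1 - noReturnProb ν) ^ v := by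
  induction v with
  | zero => simp [returnsAtLeast]
  | succ v ih =>
    have h0 : 0 ≤ 1 - noReturnProb ν := sub_nonneg.2 measureReal_le_one
    rw [pow_succ', ← ih, measureReal_def, returnsAtLeast_succ, measure_iUnion]
    · simp only [firstReturn_inter_shift _ (measurableSet_returnsAtLeast v)]
      rw [ENNReal.tsum_mul_right, ← measure_iUnion firstReturn_pairwise_disjoint
        measurableSet_firstReturn, measure_iUnion_firstReturn, ENNReal.toReal_mul,
        ENNReal.toReal_ofReal h0, measureReal_def]
    · exact fun s t hst => (firstReturn_pairwise_disjoint hst).mono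
        Set.inter_subset_left Set.inter_subset_left
    · exact fun t => (measurableSet_firstReturn t).inter
        ((measurePreserving_seqShift (ν := ν).iterate (t + 1)).measurable
          (measurableSet_returnsAtLeast v))

/-- Transience: infinitely many returns have probability at most `(1 - noReturnProb ν) ^ v` for
every `v`, hence zero; continuity from above concludes. -/
lemma tendsto_measureReal_returnsAfter (h : 0 < noReturnProb ν) :
    Tendsto (fun M => (Measure.infinitePi fun _ : ℕ => ν).real (returnsAfter E M)) atTop (𝓝 0) := by
  set P := Measure.infinitePi fun _ : ℕ => ν
  have hnull : P.real (⋂ M, returnsAfter E M) = 0 := by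
    refine le_antisymm (ge_of_tendsto' (tendsto_pow_atTop_nhds_zero_of_lt_one
      (r := 1 - noReturnProb ν) (sub_nonneg.2 measureReal_le_one) (by linarith)) fun v => ?_)
      measureReal_nonneg
    rw [← measureReal_returnsAtLeast]
    exact measureReal_mono (iInter_returnsAfter_subset v)
  rw [← hnull]
  exact (ENNReal.tendsto_toReal (measure_ne_top P _)).comp (tendsto_measure_iInter_atTop
    (fun M => (measurableSet_returnsAfter M).nullMeasurableSet) returnsAfter_antitone
    ⟨0, measure_ne_top P _⟩)

lemma tendsto_measureReal_returnCount_eq (v : ℕ) :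
    Tendsto (fun M => (Measure.infinitePi fun _ : ℕ => ν).real {w | returnCount M w = v}) atTop
      (𝓝 (noReturnProb ν * (1 - noReturnProb ν) ^ v)) := by
  set P := Measure.infinitePi fun _ : ℕ => ν
  have key : ∀ v, Tendsto (fun M => P.real {w | v ≤ returnCount M w}) atTop
      (𝓝 ((1 - noReturnProb ν) ^ v)) := by
    intro v
    rw [← measureReal_returnsAtLeast]
    have hU : returnsAtLeast E v = ⋃ M, {w | v ≤ returnCount M w} := by
      ext w; simp [returnsAtLeast]
    rw [hU]
    exact (ENNReal.tendsto_toReal (measure_ne_top P _)).comp (tendsto_measure_iUnion_atTop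
      fun M N h w hw => le_trans hw (returnCount_mono w h))
  have := (key v).sub (key (v + 1))
  rw [show (1 - noReturnProb ν) ^ v - (1 - noReturnProb ν) ^ (v + 1) =
    noReturnProb ν * (1 - noReturnProb ν) ^ v by ring] at this
  refine this.congr fun M => ?_
  rw [← measureReal_sdiff]
  · congr 1
    ext w
    simp only [Set.mem_sdiff, Set.mem_ofPred_eq]
    omega
  · exact fun w hw => (Nat.le_succ v).trans hw
  · exact measurable_returnCount M measurableSet_Ici

/-- The number of returns up to time `M` depends on the first `M` steps only, so the strong law for
finite windows applies. -/
lemma tendsto_birkhoffSum_returnCount_eq (M v : ℕ) :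
    ∀ᵐ w ∂(Measure.infinitePi fun _ : ℕ => ν),
      Tendsto (fun n : ℕ => birkhoffSum seqShift
        ({w : ℕ → E | returnCount M w = v}.indicator (1 : (ℕ → E) → ℝ)) n w / n) atTop
        (𝓝 ((Measure.infinitePi fun _ : ℕ => ν).real {w | returnCount M w = v})) := by
  have hm : MeasurableSet {w : ℕ → E | returnCount M w = v} :=
    measurable_returnCount M (measurableSet_singleton v)
  set g : (Fin M → E) → ℝ :=
    fun x => {w : ℕ → E | returnCount M w = v}.indicator 1 (extendByZero x)
  have hg : Measurable g := (measurable_one.indicator hm).comp (measurable_extendByZero M)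
  have heq : (fun w : ℕ → E => g fun i => w i) =
      {w : ℕ → E | returnCount M w = v}.indicator 1 := by
    ext w
    have : returnCount M (extendByZero fun i : Fin M => w i) = returnCount M w := by
      unfold returnCount
      congr 1
      refine Finset.filter_congr fun k hk => ?_
      rw [partialSum_extendByZero (Nat.succ_le_of_lt (Finset.mem_range.1 hk))]
    simp [g, Set.indicator_apply, this]
  have := tendsto_birkhoffSum_of_finite_range (ν := ν) hg (by
    rw [heq]; exact (integrable_const (1 : ℝ)).indicator hm)
  rwa [heq, integral_indicator_one hm] at this

/-- The number of times `i < n` whose position is visited exactly `v` times in `(i, n)`. -/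
def revisitCount (v n : ℕ) (w : ℕ → E) : ℕ :=
  ((Finset.range n).filter fun i => returnCount (n - 1 - i) (seqShift^[i] w) = v).card

-- The horizons `n - 1 - i` and `M` give the same number of returns unless `i` is among the last `M
-- + 1` times or the walk from time `i` returns after more than `M` steps. Each exceptional `i`
-- costs at most one.
omit [MeasurableSpace E] [MeasurableAdd₂ E] [MeasurableSingletonClass E] in
lemma abs_revisitCount_sub_birkhoffSum_le (v M n : ℕ) (w : ℕ → E) :
    |(revisitCount v n w : ℝ) - birkhoffSum seqShift
        ({w : ℕ → E | returnCount M w = v}.indicator (1 : (ℕ → E) → ℝ)) n w| ≤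
      (M + 1) + birkhoffSum seqShift ((returnsAfter E M).indicator (1 : (ℕ → E) → ℝ)) n w := by
  have hlate : ∑ i ∈ Finset.range n, (if n ≤ i + (M + 1) then (1 : ℝ) else 0) ≤ M + 1 := by
    rw [← Finset.sum_filter, Finset.sum_const, nsmul_eq_mul, mul_one]
    have : (Finset.range n).filter (fun i => n ≤ i + (M + 1)) ⊆ Finset.Ico (n - (M + 1)) n := by
      intro i
      simp only [Finset.mem_filter, Finset.mem_range, Finset.mem_Ico]
      omega
    have := Finset.card_le_card this
    rw [Nat.card_Ico] at this
    exact_mod_cast this.trans (by omega)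
  refine le_trans ?_ (add_le_add_left hlate _)
  rw [revisitCount, Finset.card_filter]
  push_cast
  rw [birkhoffSum, birkhoffSum, ← Finset.sum_sub_distrib, ← Finset.sum_add_distrib]
  refine (Finset.abs_sum_le_sum_abs _ _).trans (Finset.sum_le_sum fun i hi => ?_)
  have hle : |(if returnCount (n - 1 - i) (seqShift^[i] w) = v then (1 : ℝ) else 0) -
      {w : ℕ → E | returnCount M w = v}.indicator 1 (seqShift^[i] w)| ≤ 1 := by
    simp only [Set.indicator_apply, Set.mem_ofPred_eq, Pi.one_apply]
    split_ifs <;> norm_num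
  have hind : 0 ≤ (returnsAfter E M).indicator (1 : (ℕ → E) → ℝ) (seqShift^[i] w) :=
    Set.indicator_nonneg (fun _ _ => zero_le_one) _
  by_cases h₁ : n ≤ i + (M + 1)
  · rw [if_pos h₁]
    linarith
  by_cases h₂ : seqShift^[i] w ∈ returnsAfter E M
  · rw [if_neg h₁, Set.indicator_of_mem h₂, Pi.one_apply, zero_add]
    exact hle
  · rw [returnCount_eq_of_notMem_returnsAfter (by omega) h₂]
    simp [Set.indicator_apply, h₁, h₂]

/-- For every `M ≥ M₀` the exceptional set lies in one of measure at most `P.real (returnsAfter E M)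
/ ε`, by the maximal inequality, and this tends to zero. The `M` obtained depends on `w` but not on
`n`. -/
lemma ae_exists_birkhoffSum_returnsAfter_le (h : 0 < noReturnProb ν) {ε : ℝ} (hε : 0 < ε)
    (M₀ : ℕ) :
    ∀ᵐ w ∂(Measure.infinitePi fun _ : ℕ => ν), ∃ M, M₀ ≤ M ∧
      ∀ n : ℕ, birkhoffSum seqShift ((returnsAfter E M).indicator (1 : (ℕ → E) → ℝ)) n w ≤
        ε * n := by
  set P := Measure.infinitePi fun _ : ℕ => ν
  rw [ae_iff, ← measureReal_eq_zero_iff]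
  have hlim : Tendsto (fun M => P.real (returnsAfter E M) / ε) atTop (𝓝 0) := by
    simpa using (tendsto_measureReal_returnsAfter h).div_const ε
  refine le_antisymm (ge_of_tendsto hlim ?_) measureReal_nonneg
  filter_upwards [eventually_ge_atTop M₀] with M hM
  refine le_trans (measureReal_mono ?_) (measureReal_exists_lt_birkhoffSum_le
    (measurePreserving_seqShift (ν := ν)) (measurableSet_returnsAfter M) hε)
  intro w hw
  simp only [Set.mem_ofPred_eq] at hw ⊢
  push Not at hw
  exact hw M hM

/-- The frequency of the times whose position is later visited exactly `v` times. -/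
theorem tendsto_revisitCount_div (h : 0 < noReturnProb ν) :
    ∀ᵐ w ∂(Measure.infinitePi fun _ : ℕ => ν), ∀ v : ℕ,
      Tendsto (fun n : ℕ => (revisitCount v n w : ℝ) / n) atTop
        (𝓝 (noReturnProb ν * (1 - noReturnProb ν) ^ v)) := by
  rw [ae_all_iff]
  intro v
  set P := Measure.infinitePi fun _ : ℕ => ν
  set p := noReturnProb ν * (1 - noReturnProb ν) ^ v
  have hlim : ∀ j : ℕ, ∃ M₀, ∀ M ≥ M₀, |P.real {w | returnCount M w = v} - p| < 1 / (j + 1) := by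
    intro j
    have := Metric.tendsto_atTop.1 (tendsto_measureReal_returnCount_eq (ν := ν) v)
      (1 / (j + 1 : ℝ)) Nat.one_div_pos_of_nat
    simpa only [Real.dist_eq] using this
  choose M₀ hM₀ using hlim
  have h₁ : ∀ᵐ w ∂P, ∀ j : ℕ, ∃ M, M₀ j ≤ M ∧ ∀ n : ℕ, birkhoffSum seqShift
      ((returnsAfter E M).indicator (1 : (ℕ → E) → ℝ)) n w ≤ 1 / (j + 1 : ℝ) * n :=
    ae_all_iff.2 fun j => ae_exists_birkhoffSum_returnsAfter_le h Nat.one_div_pos_of_nat _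
  have h₂ : ∀ᵐ w ∂P, ∀ M, Tendsto (fun n : ℕ => birkhoffSum seqShift
        ({w : ℕ → E | returnCount M w = v}.indicator (1 : (ℕ → E) → ℝ)) n w / n) atTop
        (𝓝 (P.real {w | returnCount M w = v})) :=
    ae_all_iff.2 fun M => tendsto_birkhoffSum_returnCount_eq M v
  filter_upwards [h₁, h₂] with w hw₁ hw₂
  rw [Metric.tendsto_atTop']
  intro ε hε
  -- Four errors share `ε`: the last `M + 1` times, the late returns, the strong law at horizon `M`,
  -- and the distance from the truncated law to its limit `p`.
  obtain ⟨j, hj⟩ := exists_nat_one_div_lt (show 0 < ε / 4 by positivity)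
  obtain ⟨M, hM, hB⟩ := hw₁ j
  have hp := hM₀ j M hM
  have hsmall : Tendsto (fun n : ℕ => ((M : ℝ) + 1) / n) atTop (𝓝 0) :=
    tendsto_const_div_atTop_nhds_zero_nat _
  have hev := ((Metric.tendsto_nhds.1 (hw₂ M) (ε / 4) (by positivity)).and
    (hsmall.eventually_lt_const (show 0 < ε / 4 by positivity))).and (eventually_gt_atTop 0)
  obtain ⟨N, hN⟩ := eventually_atTop.1 hev
  refine ⟨N, fun n hn => ?_⟩
  obtain ⟨⟨hn₁, hn₂⟩, hn₃⟩ := hN n hn.le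
  have hn' : (0 : ℝ) < n := by exact_mod_cast hn₃
  have hcmp := abs_revisitCount_sub_birkhoffSum_le v M n w
  set s := birkhoffSum seqShift
    ({w : ℕ → E | returnCount M w = v}.indicator (1 : (ℕ → E) → ℝ)) n w
  have hcmp' : |(revisitCount v n w : ℝ) / n - s / n| ≤ ((M : ℝ) + 1) / n + 1 / (j + 1 : ℝ) := by
    rw [← sub_div, abs_div, abs_of_pos hn', div_le_iff₀ hn', add_mul, div_mul_cancel₀ _ hn'.ne']
    linarith [hB n]
  rw [Real.dist_eq] at hn₁ ⊢
  calc |(revisitCount v n w : ℝ) / n - p|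
      ≤ |(revisitCount v n w : ℝ) / n - s / n| + |s / n - P.real {w | returnCount M w = v}| +
        |P.real {w | returnCount M w = v} - p| := by
        refine (abs_sub_le _ (P.real {w | returnCount M w = v}) _).trans ?_
        gcongr
        exact abs_sub_le _ _ _
    _ < ε := by linarith

end Returns

/-! ### Counting sites through times. -/

section Combinatorics

/-- A finite set of naturals has exactly one element with `v` larger elements if `v` is less than
its cardinality, and none otherwise. -/
lemma card_filter_card_filter_lt (I : Finset ℕ) (v : ℕ) :
    (I.filter fun i => (I.filter fun j => i < j).card = v).card = if v < I.card then 1 else 0 := by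
  -- The rank from the top is strictly decreasing on `I`, hence a bijection from `I` onto `0, ...,
  -- I.card - 1`.
  set r : ℕ → ℕ := fun i => (I.filter fun j => i < j).card
  have hlt : ∀ i ∈ I, ∀ j ∈ I, i < j → r j < r i := by
    intro i _ j hj hij
    refine Finset.card_lt_card (Finset.ssubset_iff_of_subset ?_ |>.2 ⟨j, by simp [hj, hij]⟩)
    intro k
    simp only [Finset.mem_filter]
    exact fun hk => ⟨hk.1, hij.trans hk.2⟩
  have hinj : Set.InjOn r I := by
    intro i hi j hj hij
    rcases lt_trichotomy i j with h | h | h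
    · exact absurd hij (hlt i hi j hj h).ne'
    · exact h
    · exact absurd hij (hlt j hj i hi h).ne
  have hmaps : ∀ i ∈ I, r i ∈ Finset.range I.card := fun i hi => by
    rw [Finset.mem_range]
    exact Finset.card_lt_card (Finset.ssubset_iff_of_subset (Finset.filter_subset _ _) |>.2
      ⟨i, hi, by simp⟩)
  have himg : I.image r = Finset.range I.card :=
    Finset.eq_of_subset_of_card_le (Finset.image_subset_iff.2 hmaps)
      (by rw [Finset.card_image_of_injOn hinj, Finset.card_range])
  split_ifs with hv
  · obtain ⟨i, hi, hiv⟩ := Finset.mem_image.1 (himg ▸ Finset.mem_range.2 hv)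
    rw [Finset.card_eq_one]
    refine ⟨i, ?_⟩
    ext j
    simp only [Finset.mem_filter, Finset.mem_singleton]
    constructor
    · rintro ⟨hj, hjv⟩
      exact hinj hj hi (hjv.trans hiv.symm)
    · rintro rfl
      exact ⟨hi, hiv⟩
  · rw [Finset.card_eq_zero, Finset.filter_eq_empty_iff]
    intro i hi h
    exact hv (Finset.mem_range.1 (h ▸ hmaps i hi))

/-- The number of values taken more than `v` times by `s` on `[0, n)` is the number of times `i < n`
at which the value has exactly `v` later occurrences. -/
lemma card_filter_later_eq {α : Type*} [DecidableEq α] (s : ℕ → α) (n v : ℕ) :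
    ((Finset.range n).filter fun i =>
      ((Finset.range n).filter fun j => i < j ∧ s j = s i).card = v).card =
    (((Finset.range n).image s).filter fun x =>
      v < ((Finset.range n).filter fun j => s j = x).card).card := by
  -- Group the times by their value: on each fibre the preceding rank count applies to the set of
  -- visit times.
  rw [Finset.card_eq_sum_card_fiberwise (f := s) (t := (Finset.range n).image s)
    fun i hi => Finset.mem_image_of_mem s (Finset.mem_of_mem_filter i hi), Finset.card_filter]
  refine Finset.sum_congr rfl fun x _ => ?_
  rw [← card_filter_card_filter_lt, Finset.filter_filter, Finset.filter_filter]
  congr 1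
  refine Finset.filter_congr fun i _ => ?_
  rw [and_comm]
  refine and_congr_right fun hx => ?_
  rw [Finset.filter_filter, hx]
  simp only [and_comm]

variable {E : Type*} [AddCommGroup E] [DecidableEq E]

lemma returnCount_seqShift_iterate (w : ℕ → E) {n i : ℕ} (hi : i < n) :
    returnCount (n - 1 - i) (seqShift^[i] w) =
      ((Finset.range n).filter fun j => i < j ∧ partialSum w j = partialSum w i).card := by
  unfold returnCount
  refine Finset.card_bij' (fun k _ => i + (k + 1)) (fun j _ => j - i - 1) ?_ ?_ ?_ ?_
  · intro k hk
    simp only [Finset.mem_filter, Finset.mem_range] at hk ⊢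
    refine ⟨by omega, by omega, ?_⟩
    rw [partialSum_add, hk.2, add_zero]
  · intro j hj
    simp only [Finset.mem_filter, Finset.mem_range] at hj ⊢
    refine ⟨by omega, ?_⟩
    have h := partialSum_add w i (j - i - 1 + 1)
    rw [show i + (j - i - 1 + 1) = j by omega, hj.2.2] at h
    exact left_eq_add.1 h
  · intro k _
    omega
  · intro j hj
    simp only [Finset.mem_filter, Finset.mem_range] at hj
    omega

lemma revisitCount_eq_card (v n : ℕ) (w : ℕ → E) :
    revisitCount v n w = (((Finset.range n).image (partialSum w)).filter fun x =>
      v < ((Finset.range n).filter fun j => partialSum w j = x).card).card := by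
  rw [← card_filter_later_eq, revisitCount]
  congr 1
  refine Finset.filter_congr fun i hi => ?_
  rw [returnCount_seqShift_iterate w (Finset.mem_range.1 hi)]

end Combinatorics

/-! ### Conditional law of the local time and the limit theorem. -/

namespace LatticeWalk

variable {Ω : Type*} {d : ℕ}

lemma walk_eq_partialSum (X : ℕ → Ω → (Fin d → ℤ)) (n : ℕ) (ω : Ω) :
    walk X n ω = partialSum (fun i => X i ω) n := rfl

lemma localTime_eq_card (X : ℕ → Ω → (Fin d → ℤ)) (n : ℕ) (x : Fin d → ℤ) (ω : Ω) :
    localTime X n x ω =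
      ((Finset.range (n + 1)).filter fun j => partialSum (fun i => X i ω) j = x).card := by
  rw [localTime, Finset.card_filter]
  exact Finset.sum_congr rfl fun i _ => if_congr Iff.rfl rfl rfl

lemma visited_eq_image (X : ℕ → Ω → (Fin d → ℤ)) (n : ℕ) (ω : Ω) :
    visited X n ω = ((Finset.range (n + 1)).image (partialSum fun i => X i ω) : Finset _) := by
  ext x
  simp [visited, walk_eq_partialSum]

/-- The proportion of the visited sites that are visited exactly `u` times. -/
lemma uniformOn_visited_localTime_eq (X : ℕ → Ω → (Fin d → ℤ)) (n : ℕ) (ω : Ω) {u : ℕ}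
    (hu : 1 ≤ u) :
    (uniformOn (visited X n ω)).real {x | localTime X n x ω = u} =
      ((revisitCount (u - 1) (n + 1) (fun i => X i ω) : ℝ) -
        revisitCount u (n + 1) (fun i => X i ω)) / revisitCount 0 (n + 1) (fun i => X i ω) := by
  set w : ℕ → Fin d → ℤ := fun i => X i ω
  set R := (Finset.range (n + 1)).image (partialSum w)
  set L : (Fin d → ℤ) → ℕ :=
    fun x => ((Finset.range (n + 1)).filter fun j => partialSum w j = x).card
  have hset : (visited X n ω ∩ {x | localTime X n x ω = u}) =
      (R.filter fun x => L x = u : Finset _) := by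
    ext x
    simp only [visited_eq_image, Set.mem_inter_iff, Finset.coe_filter, Set.mem_ofPred_eq,
      localTime_eq_card, Finset.mem_coe]
    rfl
  have hfin : (visited X n ω).Finite := by
    rw [visited_eq_image]
    exact Finset.finite_toSet _
  have h0 : revisitCount 0 (n + 1) w = R.card := by
    rw [revisitCount_eq_card]
    refine congrArg _ (Finset.filter_true_of_mem fun x hx => ?_)
    obtain ⟨i, hi, rfl⟩ := Finset.mem_image.1 hx
    exact Finset.card_pos.2 ⟨i, Finset.mem_filter.2 ⟨hi, rfl⟩⟩
  -- Since `u ≥ 1`, more than `u - 1` visits means either more than `u` or exactly `u`; for `u = 0`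
  -- the truncated subtraction would break this.
  have hsplit : revisitCount (u - 1) (n + 1) w =
      revisitCount u (n + 1) w + (R.filter fun x => L x = u).card := by
    rw [revisitCount_eq_card, revisitCount_eq_card, ← Finset.card_union_of_disjoint,
      ← Finset.filter_or]
    · congr 1
      refine Finset.filter_congr fun x _ => ?_
      change u - 1 < L x ↔ u < L x ∨ L x = u
      omega
    · refine Finset.disjoint_filter.2 fun x _ h₁ h₂ => ?_
      exact h₁.ne' h₂
  rw [h0, hsplit, measureReal_def, ← uniformOn_inter_self hfin, hset, visited_eq_image,
    uniformOn_apply_finset, ENNReal.toReal_div, Finset.inter_eq_right.2 (Finset.filter_subset _ _)]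
  simp only [Nat.cast_add, add_sub_cancel_left, ENNReal.toReal_natCast]
  rfl

variable [MeasurableSpace Ω] {μ : Measure Ω} {X : ℕ → Ω → (Fin d → ℤ)}

lemma measurable_walk (hX : ∀ i, Measurable (X i)) (n : ℕ) : Measurable (walk X n) :=
  Finset.measurable_fun_sum _ fun i _ => hX i

lemma measurableSet_localTime_eq (hX : ∀ i, Measurable (X i)) {Z : Ω → (Fin d → ℤ)}
    (hZ : Measurable Z) (n u : ℕ) : MeasurableSet {ω | localTime X n (Z ω) ω = u} := by
  have : Measurable fun ω => localTime X n (Z ω) ω := by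
    unfold localTime
    exact Finset.measurable_fun_sum _ fun i _ => Measurable.ite
      (measurableSet_eq_fun (measurable_walk hX i) hZ) measurable_const measurable_const
  exact this (measurableSet_singleton u)

omit [MeasurableSpace Ω] in
lemma localTime_congr {n : ℕ} {ω ω' : Ω} (h : ∀ i < n, X i ω = X i ω') (x : Fin d → ℤ) :
    localTime X n x ω = localTime X n x ω' := by
  refine Finset.sum_congr rfl fun i hi => ?_
  have : walk X i ω = walk X i ω' := Finset.sum_congr rfl fun j hj =>
    h j ((Finset.mem_range.1 hj).trans_le (Nat.le_of_lt_succ (Finset.mem_range.1 hi)))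
  rw [this]

/-- The conditional law of the local time at a uniformly chosen visited site. -/
lemma condExp_localTime_eq [IsProbabilityMeasure μ] (hX : ∀ i, Measurable (X i)) {n : ℕ}
    {Z : Ω → (Fin d → ℤ)} (hZ : IsUniformOnVisited X μ n Z) (u : ℕ) :
    μ⟦{ω | localTime X n (Z ω) ω = u} | stepsSigma X n⟧ =ᵐ[μ]
      fun ω => (uniformOn (visited X n ω)).real {x | localTime X n x ω = u} := by
  set F : Ω → Fin n → Fin d → ℤ := fun ω i => X i ω
  have hE : MeasurableSet {ω | localTime X n (Z ω) ω = u} := measurableSet_localTime_eq hX hZ.1 n u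
  -- The first `n` steps take countably many values. On each atom `F ω = p` the local time is a
  -- fixed function of the site, so the event becomes `Z ∈ A` for a fixed set `A`, and conditional
  -- expectation localizes to the atom.
  have hatom : ∀ p : Fin n → Fin d → ℤ, ∀ᵐ ω ∂μ, F ω = p →
      (μ⟦{ω | localTime X n (Z ω) ω = u} | stepsSigma X n⟧) ω =
        (uniformOn (visited X n ω)).real {x | localTime X n x ω = u} := by
    intro p
    by_cases hp : ∃ ω₀, F ω₀ = p
    swap
    · exact ae_of_all _ fun ω hω => absurd ⟨ω, hω⟩ hp
    obtain ⟨ω₀, hω₀⟩ := hp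
    set A : Set (Fin d → ℤ) := {x | localTime X n x ω₀ = u}
    have hA : ∀ ω, F ω = p → {x | localTime X n x ω = u} = A := by
      intro ω hω
      ext x
      change _ = u ↔ _ = u
      rw [localTime_congr fun i hi => congrFun (hω.trans hω₀.symm) ⟨i, hi⟩]
    have hs : MeasurableSet[stepsSigma X n] (F ⁻¹' {p}) := ⟨{p}, measurableSet_singleton p, rfl⟩
    have hZA : MeasurableSet (Z ⁻¹' A) := hZ.1 A.to_countable.measurableSet
    have h₁ := condExp_indicator (μ := μ) (m := stepsSigma X n)
      ((integrable_const (1 : ℝ)).indicator hE) hs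
    have h₂ := condExp_indicator (μ := μ) (m := stepsSigma X n)
      ((integrable_const (1 : ℝ)).indicator hZA) hs
    have heq : (F ⁻¹' {p}).indicator ({ω | localTime X n (Z ω) ω = u}.indicator fun _ => (1 : ℝ)) =
        (F ⁻¹' {p}).indicator ((Z ⁻¹' A).indicator fun _ => (1 : ℝ)) := by
      refine Set.indicator_congr fun ω hω => ?_
      have : ω ∈ {ω | localTime X n (Z ω) ω = u} ↔ ω ∈ Z ⁻¹' A := by
        rw [Set.mem_preimage, ← hA ω hω]
        rfl
      by_cases h : ω ∈ Z ⁻¹' A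
      · rw [Set.indicator_of_mem h, Set.indicator_of_mem (this.2 h)]
      · rw [Set.indicator_of_notMem h, Set.indicator_of_notMem (mt this.1 h)]
    rw [heq] at h₁
    filter_upwards [h₁, h₂, hZ.2 A A.to_countable.measurableSet] with ω h₁ h₂ h₃ hω
    have hmem : ω ∈ F ⁻¹' {p} := hω
    rw [h₁, Set.indicator_of_mem hmem, Set.indicator_of_mem hmem, h₃] at h₂
    rw [h₂, hA ω hω]
  filter_upwards [ae_all_iff.2 hatom] with ω hω using hω _ rfl

lemma noReturnProb_map_eq_escapeProb [IsProbabilityMeasure μ]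
    (hX : ∀ i, Measurable (X i)) (hlaw : μ.map (fun ω i => X i ω) =
      Measure.infinitePi fun _ : ℕ => μ.map (X 0)) :
    noReturnProb (μ.map (X 0)) = escapeProb X μ := by
  rw [noReturnProb, ← hlaw, escapeProb, map_measureReal_apply (measurable_pi_lambda _ hX)]
  · rfl
  · simp only [Set.ofPred_forall]
    exact .iInter fun n => .iInter fun _ => (measurableSet_partialSum_eq_zero n).compl

end LatticeWalk

theorem theorem2 {Ω : Type*} [MeasurableSpace Ω] (μ : Measure Ω) [IsProbabilityMeasure μ]
    (d : ℕ) (hd : 1 ≤ d)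
    (X : ℕ → Ω → (Fin d → ℤ))
    (hXmeas : ∀ i, Measurable (X i))
    (hXindep : iIndepFun X μ)
    (hXident : ∀ i, IdentDistrib (X i) (X 0) μ μ)
    (hgen : LatticeWalk.GenuinelyDDimensional X μ)
    (hpos : 0 < LatticeWalk.escapeProb X μ)
    (hlt : LatticeWalk.escapeProb X μ < 1)
    (hlow : d ≤ 2 → LatticeWalk.FiniteSecondMoment X μ ∨ LatticeWalk.PolynomialReturnTail X μ)
    (Y : ℕ → Ω → (Fin d → ℤ))
    (hY : ∀ n, LatticeWalk.IsUniformOnVisited X μ n (Y n)) :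
    ∀ᵐ ω ∂μ, ∀ u : ℕ, 1 ≤ u →
      Tendsto
        (fun n : ℕ =>
          (μ⟦{ω' | LatticeWalk.localTime X n (Y n ω') ω' = u} | LatticeWalk.stepsSigma X n⟧) ω)
        atTop
        (𝓝 (LatticeWalk.escapeProb X μ * (1 - LatticeWalk.escapeProb X μ) ^ (u - 1))) := by
  have hlaw : μ.map (fun ω i => X i ω) = Measure.infinitePi fun _ : ℕ => μ.map (X 0) := by
    rw [hXindep.map_fun_eq_infinitePi_map hXmeas]
    congr 1
    exact funext fun i => (hXident i).map_eq
  have := Measure.isProbabilityMeasure_map (μ := μ) (hXmeas 0).aemeasurable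
  have hγ := LatticeWalk.noReturnProb_map_eq_escapeProb hXmeas hlaw
  have hfreq := tendsto_revisitCount_div (ν := μ.map (X 0)) (hγ ▸ hpos)
  rw [← hlaw, hγ] at hfreq
  have hcond : ∀ᵐ ω ∂μ, ∀ n u : ℕ,
      (μ⟦{ω' | LatticeWalk.localTime X n (Y n ω') ω' = u} | LatticeWalk.stepsSigma X n⟧) ω =
        (uniformOn (LatticeWalk.visited X n ω)).real {x | LatticeWalk.localTime X n x ω = u} :=
    ae_all_iff.2 fun n => ae_all_iff.2 fun u => LatticeWalk.condExp_localTime_eq hXmeas (hY n) u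
  filter_upwards [ae_of_ae_map (measurable_pi_lambda _ hXmeas).aemeasurable hfreq, hcond]
    with ω hω hc u hu
  set γ := LatticeWalk.escapeProb X μ
  -- The times `0, ..., n` are `n + 1` in number, hence the shift of the index by one. The limit of
  -- the denominator is the escape probability, which is nonzero.
  have hlim := (((hω (u - 1)).sub (hω u)).div (hω 0) (by simpa using hpos.ne')).comp
    (tendsto_add_atTop_nat 1)
  have hval : (γ * (1 - γ) ^ (u - 1) - γ * (1 - γ) ^ u) / (γ * (1 - γ) ^ 0) =
      γ * (1 - γ) ^ (u - 1) := by
    obtain ⟨v, rfl⟩ := Nat.exists_eq_add_of_le' hu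
    rw [Nat.add_sub_cancel, div_eq_iff (by simpa using hpos.ne')]
    ring
  rw [hval] at hlim
  refine hlim.congr fun n => ?_
  rw [hc, LatticeWalk.uniformOn_visited_localTime_eq X n ω hu]
  have hn : ((n + 1 : ℕ) : ℝ) ≠ 0 := by positivity
  simp only [Function.comp_apply, Pi.div_apply]
  rw [← sub_div, div_div_div_cancel_right₀ hn]
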